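/- Let $G$ be a finite simple graph with $n\ge 1$ vertices. Its Lovász number is $$\vartheta(G)=\min_{U,\,c}\ \max_{i}\ \frac{1}{\langle c,u_i\rangle^2},$$ where $U=(u_i)_{i\in V(G)}$ ranges over all orthonormal representations of $G$, that is, families of real unit vectors in some $\mathbb{R}^N$ ($N$ arbitrary) with $\langle u_i,u_j\rangle=0$ whenever $i\neq j$ are not adjacent, and $c$ ranges over the unit vectors of the same $\mathbb{R}^N$ (with $1/0=+\infty$). A real symmetric weighted adjacency matrix of $G$ is a real symmetric matrix $A$ indexed by $V(G)$ with $A_{ij}=0$ whenever $i$ and $j$ are not adjacent (in particular $A_{ii}=0$). Let $\mathbf 1\in\mathbb{R}^n$ be the all-ones vector and $\mathcal S_n=\{v\in\mathbb{R}^n : |v-\tfrac12\mathbf 1|^2=\tfrac n4\}=\{v\in\mathbb{R}^n : \langle \mathbf 1,v\rangle=|v|^2\}$. The spherical independence number of $G$ is $$\alpha_{\mathcal S}(G)=\inf_A\ \sup\{\,|v|^2 : v\in\mathcal S_n,\ \langle v,Av\rangle=0\,\},$$ where $A$ ranges over all real symmetric weighted adjacency matrices of $G$. For such an $A$, with spectrum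 $\sigma(A)$ and orthogonal projections $P_\mu$ onto its eigenspaces, the weighted walk-generating function is $$W_A(x)=\langle \mathbf 1,(I-xA)^{-1}\mathbf 1\rangle=\sum_{\mu\in\sigma(A)}\frac{\langle \mathbf 1,P_\mu\mathbf 1\rangle}{1-\mu x},$$ where terms with $\langle \mathbf 1,P_\mu\mathbf 1\rangle=0$ are dropped (so that $W_A(\mu^{-1})$ is defined for such $\mu\ne0$); at the remaining poles, which can meet the interval below only in its endpoints, $W_A$ is regarded as $+\infty$. Let $\lambda_{\min}(A),\lambda_{\max}(A)$ be the smallest and largest eigenvalues of $A$; for $A\neq 0$ they are strictly negative and strictly positive, and for $A=0$ the interval $[\lambda_{\min}(A)^{-1},\lambda_{\max}(A)^{-1}]$ is read as $(-\infty,+\infty)$, on which $W_0\equiv n$. Then the minima below and in the definition of $\vartheta(G)$ are attained, and $$\vartheta(G)\;=\;\alpha_{\mathcal S}(G)\;=\;\inf_A\ \min\bigl\{\,W_A(x) : x\in[\lambda_{\min}(A)^{-1},\lambda_{\max}(A)^{-1}]\,\bigr\},$$ where $A$ ranges over all real symmetric weighted adjacency matrices of $G$. -/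

import Mathlib

open scoped Matrix

noncomputable section

namespace SphericalTheta

variable {V : Type*} [Fintype V]

/-- `u` is an orthonormal representation of `G` in `ℝ^N`: real unit vectors indexed by the vertices,
with distinct nonadjacent vertices sent to orthogonal vectors. -/
def IsOrthonormalRep (G : SimpleGraph V) {N : ℕ} (u : V → EuclideanSpace ℝ (Fin N)) : Prop :=
  (∀ i, ‖u i‖ = 1) ∧ ∀ i j, i ≠ j → ¬ G.Adj i j → inner ℝ (u i) (u j) = 0

/-- The finite values `max_i 1 / ⟨c, u_i⟩²`, over all `N`, all orthonormal representations `u` of `G`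
in `ℝ^N` and all unit vectors `c` of `ℝ^N`. The pairs with some `⟨c, u_i⟩ = 0` are left out, since
there the maximum is `+∞`. -/
def lovaszValues (G : SimpleGraph V) : Set ℝ :=
  {t | ∃ (N : ℕ) (u : V → EuclideanSpace ℝ (Fin N)) (c : EuclideanSpace ℝ (Fin N)),
    IsOrthonormalRep G u ∧ ‖c‖ = 1 ∧ (∀ i, inner ℝ c (u i) ≠ 0) ∧
      t = ⨆ i, 1 / (inner ℝ c (u i)) ^ 2}

/-- The Lovász number. -/
def lovaszNumber (G : SimpleGraph V) : ℝ := sInf (lovaszValues G)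

/-- The real symmetric weighted adjacency matrices of `G` (any real weights, zero included, on the
edges, and zero entries elsewhere, in particular on the diagonal). -/
def weightedAdjacency (G : SimpleGraph V) : Set (Matrix V V ℝ) :=
  {A | A.IsSymm ∧ ∀ i j, ¬ G.Adj i j → A i j = 0}

/-- The all-ones vector. -/
def ones : EuclideanSpace ℝ V := WithLp.toLp 2 fun _ => 1

/-- The sphere in `ℝ^n` with centre `𝟏 / 2` and squared radius `n / 4`. -/
def indepSphere : Set (EuclideanSpace ℝ V) :=
  {v | ‖v - (1 / 2 : ℝ) • ones‖ ^ 2 = (Fintype.card V : ℝ) / 4}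

variable [DecidableEq V]

/-- The spherical independence number
`inf_A sup {|v|² | v on the sphere, ⟨v, A v⟩ = 0}`. -/
def sphericalIndepNumber (G : SimpleGraph V) : ℝ :=
  ⨅ A : weightedAdjacency G,
    sSup {s : ℝ | ∃ v ∈ indepSphere (V := V),
      inner ℝ v (Matrix.toEuclideanLin (A : Matrix V V ℝ) v) = 0 ∧ s = ‖v‖ ^ 2}

/-- The largest eigenvalue of a real symmetric matrix. -/
def maxEigenvalue (A : Matrix V V ℝ) : ℝ := sSup (spectrum ℝ A)

/-- The smallest eigenvalue of a real symmetric matrix. -/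
def minEigenvalue (A : Matrix V V ℝ) : ℝ := sInf (spectrum ℝ A)

/-- `⟨𝟏, P_μ 𝟏⟩`, with `P_μ` the orthogonal projection onto the `μ`-eigenspace of `A`. -/
def eigenWeight (A : Matrix V V ℝ) (μ : ℝ) : ℝ :=
  inner ℝ ones
    ((Module.End.eigenspace (Matrix.toEuclideanLin A) μ).starProjection (ones (V := V)))

/-- The set of points at which the weighted walk-generating function is defined (it has a pole at
`x = μ⁻¹` exactly when `μ` is a nonzero eigenvalue with `⟨𝟏, P_μ 𝟏⟩ ≠ 0`). -/
def walkDomain (A : Matrix V V ℝ) : Set ℝ :=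
  {x | ∀ μ ∈ spectrum ℝ A, 1 - μ * x = 0 → eigenWeight A μ = 0}

/-- The weighted walk-generating function `W_A(x) = ∑_{μ ∈ σ(A)} ⟨𝟏, P_μ 𝟏⟩ / (1 - μ x)`, meaningful
for `x ∈ walkDomain A`; there a term with `1 - μ x = 0` has `⟨𝟏, P_μ 𝟏⟩ = 0` and is dropped
(in Lean, `0 / 0 = 0`). It is `⟨𝟏, (I - x A)⁻¹ 𝟏⟩` wherever `I - x A` is invertible, see
`walkGen_eq_inverse`. -/
def walkGen (A : Matrix V V ℝ) (x : ℝ) : ℝ :=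
  ∑ μ ∈ (Matrix.finite_real_spectrum (A := A)).toFinset, eigenWeight A μ / (1 - μ * x)

/-- Where `I - x A` is invertible, `W_A(x) = ⟨𝟏, (I - x A)⁻¹ 𝟏⟩`. -/
theorem walkGen_eq_inverse {A : Matrix V V ℝ} (hA : A.IsSymm) {x : ℝ}
    (hx : IsUnit (1 - x • A)) :
    walkGen A x = inner ℝ ones (Matrix.toEuclideanLin (1 - x • A)⁻¹ (ones (V := V))) := by
  classical
  set T := Matrix.toEuclideanLin A with hT
  have hTs : T.IsSymmetric := Matrix.isSymmetric_toEuclideanLin_iff.mpr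
    (by rw [Matrix.IsHermitian, Matrix.conjTranspose_eq_transpose_of_trivial]; exact hA)
  have hspec : spectrum ℝ T = spectrum ℝ A := Matrix.spectrum_toLpLin 2
  have hlin : ∀ v : EuclideanSpace ℝ V,
      Matrix.toEuclideanLin (1 - x • A) v = v - x • T v := by
    intro v
    simp [Matrix.toEuclideanLin, hT, Matrix.toLpLin_one]
  have hdet : IsUnit (1 - x • A).det := (Matrix.isUnit_iff_isUnit_det _).mp hx
  set w := Matrix.toEuclideanLin (1 - x • A)⁻¹ (ones (V := V)) with hw
  have hw1 : w - x • T w = ones := by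
    rw [← hlin, hw, Matrix.toEuclideanLin, Matrix.toLpLin_apply, Matrix.toLpLin_apply,
      Matrix.mulVec_mulVec, Matrix.mul_nonsing_inv _ hdet, Matrix.one_mulVec]
  have hinj : ∀ v : EuclideanSpace ℝ V, v - x • T v = 0 → v = 0 := by
    intro v hv
    rw [← hlin, Matrix.toEuclideanLin, Matrix.toLpLin_apply] at hv
    have h0 : (1 - x • A) *ᵥ v.ofLp = 0 := by simpa using hv
    have h1 : v.ofLp = 0 := by
      have := congrArg ((1 - x • A)⁻¹ *ᵥ ·) h0
      simpa [Matrix.mulVec_mulVec, Matrix.nonsing_inv_mul _ hdet] using this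
    ext i
    simpa using congrFun h1 i
  have hterm : ∀ μ ∈ (Matrix.finite_real_spectrum (A := A)).toFinset,
      eigenWeight A μ / (1 - μ * x) =
        inner ℝ ((Module.End.eigenspace T μ).starProjection (ones (V := V))) w := by
    intro μ hμ
    have hμ' : μ ∈ spectrum ℝ T := by
      rw [hspec]
      simpa using hμ
    have hev : Module.End.HasEigenvalue T μ := Module.End.HasUnifEigenvalue.of_mem_spectrum hμ'
    obtain ⟨v, hv⟩ := hev.exists_hasEigenvector
    have hne : 1 - μ * x ≠ 0 := by
      intro h0
      apply hv.2
      apply hinj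
      rw [hv.apply_eq_smul, smul_smul, ← one_smul ℝ v, smul_smul, ← sub_smul]
      rw [show (1 : ℝ) - x * μ * 1 = 1 - μ * x by ring, h0, zero_smul]
    rw [div_eq_iff hne]
    set p := (Module.End.eigenspace T μ).starProjection (ones (V := V)) with hp
    have hpT : T p = μ • p :=
      Module.End.mem_eigenspace_iff.mp (Submodule.starProjection_apply_mem _ _)
    calc eigenWeight A μ = inner ℝ p (ones (V := V)) := by
          rw [real_inner_comm]
          rfl
      _ = inner ℝ p w * (1 - μ * x) := by
          rw [← hw1, inner_sub_right, inner_smul_right, ← hTs p w, hpT, real_inner_smul_left]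
          ring
  rw [walkGen, Finset.sum_congr rfl hterm, ← sum_inner]
  congr 1
  have hsum := hTs.orthogonalFamily_eigenspaces'.sum_projection_of_mem_iSup (ones (V := V)) (by
    rw [Submodule.orthogonal_eq_bot_iff.mp hTs.orthogonalComplement_iSup_eigenspaces_eq_bot']
    exact Submodule.mem_top)
  refine Eq.trans ?_ hsum
  refine Finset.sum_bij' (fun μ hμ => (⟨μ, Module.End.HasUnifEigenvalue.of_mem_spectrum
    (by rw [hspec]; simpa using hμ)⟩ : Module.End.Eigenvalues T)) (fun μ _ => (μ : ℝ))
    ?_ ?_ ?_ ?_ ?_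
  · intros; exact Finset.mem_univ _
  · intro μ _
    have h := μ.2.mem_spectrum
    rw [hspec] at h
    exact (Set.Finite.mem_toFinset _).mpr h
  · intros; rfl
  · intros; rfl
  · intros; rfl

open Classical in
/-- The interval `[λ_min(A)⁻¹, λ_max(A)⁻¹]`, which is the whole line for `A = 0`. -/
def walkInterval (A : Matrix V V ℝ) : Set ℝ :=
  if A = 0 then Set.univ else Set.Icc (minEigenvalue A)⁻¹ (maxEigenvalue A)⁻¹

/-- The values of `W_A` on `[λ_min(A)⁻¹, λ_max(A)⁻¹]`. A pole (only an endpoint can be one) counts as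
the value `+∞` and is left out. -/
def walkValues (A : Matrix V V ℝ) : Set ℝ :=
  walkGen A '' (walkInterval A ∩ walkDomain A)

/-- `min {W_A(x) | x ∈ [λ_min(A)⁻¹, λ_max(A)⁻¹]}`. -/
def walkMin (A : Matrix V V ℝ) : ℝ := sInf (walkValues A)

end SphericalTheta

end

/-!
Write `W` for the walk-generating function of a weighted adjacency matrix `A`, and `e` for the all-ones
vector. Two facts carry the proof.

For fixed `A`, the supremum of `|v|²` over the vectors `v` of the sphere with `⟨v, A v⟩ = 0` equals
`min W` (`isGreatest_walkMin`). The interval is the set of `x` with `I - x A ≥ 0`. For such an `x`, not a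
pole, let `w` solve `(I - x A) w = e`, so `W(x) = ⟨e, w⟩`. Cauchy-Schwarz for the form `I - x A` gives
`⟨e, v⟩² ≤ W(x) ⟨v, (I - x A) v⟩` (`sq_inner_ones_le`), which on the vectors in question reads
`|v|⁴ ≤ W(x) |v|²`. Conversely `W'(x) = ⟨w, A w⟩` (`hasDerivAt_walkGen`): at a critical point `w` itself
lies on the sphere and attains the bound, and at a minimum with `W'(x) ≠ 0` some eigenvector in the
kernel of `I - x A` can be added to `w` to make `⟨v, A v⟩` vanish
(`exists_indepSphere_norm_sq_eq`).

The values defining the Lovász number are exactly the `t` for which `t I + A - J ≥ 0` for some weighted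
adjacency matrix `A`, with `J = e eᵀ` (`lovaszValues_subset_semidefValues`,
`semidefValues_subset_lovaszValues`), and a compactness argument gives a least such `t`
(`exists_isLeast_semidefValues`). If `t` is feasible with the matrix `A`, evaluating the form on the
sphere gives `min W_A ≤ t` (`exists_walkMin_le`); and for every `A`, the displayed Cauchy-Schwarz
inequality at a minimum point `x` says that `min W_A` is feasible with the matrix `-(min W_A) x A`
(`walkMin_mem_semidefValues`). Hence the least feasible `t` is the infimum of `min W_A` over `A`.
-/

noncomputable section

namespace SphericalTheta

variable {V : Type*} [Fintype V]

/-! ### Spectral decomposition -/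

theorem inner_ones (v : EuclideanSpace ℝ V) : inner ℝ ones v = ∑ i, v i := by
  simp [ones, PiLp.inner_apply]

theorem norm_ones_sq : ‖(ones : EuclideanSpace ℝ V)‖ ^ 2 = Fintype.card V := by
  simp [ones, EuclideanSpace.norm_sq_eq]

theorem mem_indepSphere_iff {v : EuclideanSpace ℝ V} :
    v ∈ indepSphere ↔ inner ℝ ones v = ‖v‖ ^ 2 := by
  rw [indepSphere, Set.mem_ofPred_eq, norm_sub_sq_real, norm_smul, mul_pow, norm_ones_sq,
    inner_smul_right, real_inner_comm]
  norm_num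
  constructor <;> intro h <;> linarith

variable [DecidableEq V]

theorem inner_toEuclideanLin (A : Matrix V V ℝ) (v : EuclideanSpace ℝ V) :
    inner ℝ v (Matrix.toEuclideanLin A v) = ∑ i, ∑ j, A i j * v i * v j := by
  simp only [PiLp.inner_apply, Matrix.toEuclideanLin, Matrix.toLpLin_apply, Matrix.mulVec,
    dotProduct, RCLike.inner_apply, conj_trivial, Finset.sum_mul]
  exact Finset.sum_congr rfl fun i _ => Finset.sum_congr rfl fun j _ => by ring

theorem isSymmetric_of_isSymm {A : Matrix V V ℝ} (hA : A.IsSymm) :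
    (Matrix.toEuclideanLin A).IsSymmetric :=
  Matrix.isSymmetric_toEuclideanLin_iff.mpr
    (by rw [Matrix.IsHermitian, Matrix.conjTranspose_eq_transpose_of_trivial]; exact hA)

/-- The real spectrum of `A` as a finset. -/
abbrev spec (A : Matrix V V ℝ) : Finset ℝ := (Matrix.finite_real_spectrum (A := A)).toFinset

/-- The orthogonal projection onto the `μ`-eigenspace of `A`. -/
abbrev eigenProj (A : Matrix V V ℝ) (μ : ℝ) : EuclideanSpace ℝ V →L[ℝ] EuclideanSpace ℝ V :=
  (Module.End.eigenspace (Matrix.toEuclideanLin A) μ).starProjection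

theorem mem_spec {A : Matrix V V ℝ} {μ : ℝ} :
    μ ∈ spec A ↔ Module.End.HasEigenvalue (Matrix.toEuclideanLin A) μ := by
  rw [Set.Finite.mem_toFinset, ← Matrix.spectrum_toLpLin 2,
    Module.End.hasEigenvalue_iff_mem_spectrum]

theorem apply_eigenProj (A : Matrix V V ℝ) (μ : ℝ) (v : EuclideanSpace ℝ V) :
    Matrix.toEuclideanLin A (eigenProj A μ v) = μ • eigenProj A μ v :=
  Module.End.mem_eigenspace_iff.mp (Submodule.starProjection_apply_mem _ _)

theorem sum_eigenProj {A : Matrix V V ℝ} (hA : A.IsSymm) (v : EuclideanSpace ℝ V) :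
    ∑ μ ∈ spec A, eigenProj A μ v = v := by
  have hTs := isSymmetric_of_isSymm hA
  have hsum := hTs.orthogonalFamily_eigenspaces'.sum_projection_of_mem_iSup v (by
    rw [Submodule.orthogonal_eq_bot_iff.mp hTs.orthogonalComplement_iSup_eigenspaces_eq_bot']
    exact Submodule.mem_top)
  refine Eq.trans ?_ hsum
  refine Finset.sum_bij' (fun μ hμ => (⟨μ, mem_spec.mp hμ⟩ :
    Module.End.Eigenvalues (Matrix.toEuclideanLin A))) (fun μ _ => (μ : ℝ)) ?_ ?_ ?_ ?_ ?_
  · intros; exact Finset.mem_univ _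
  · intro μ _
    exact mem_spec.mpr μ.2
  all_goals intros; rfl

theorem inner_eq_zero_of_eigen {A : Matrix V V ℝ} (hA : A.IsSymm) {μ ν : ℝ} (h : μ ≠ ν)
    {v z : EuclideanSpace ℝ V} (hv : Matrix.toEuclideanLin A v = μ • v)
    (hz : Matrix.toEuclideanLin A z = ν • z) : inner ℝ v z = 0 := by
  have := isSymmetric_of_isSymm hA v z
  rw [hv, hz, real_inner_smul_left, real_inner_smul_right] at this
  have h2 : (μ - ν) * inner ℝ v z = 0 := by linarith
  exact (mul_eq_zero.mp h2).resolve_left (sub_ne_zero.mpr h)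

/-- Spectral combinations of a vector are multiplied term by term. -/
theorem inner_sum_smul_eigenProj {A : Matrix V V ℝ} (hA : A.IsSymm) (f g : ℝ → ℝ)
    (v : EuclideanSpace ℝ V) :
    inner ℝ (∑ μ ∈ spec A, f μ • eigenProj A μ v) (∑ μ ∈ spec A, g μ • eigenProj A μ v) =
      ∑ μ ∈ spec A, f μ * g μ * ‖eigenProj A μ v‖ ^ 2 := by
  rw [sum_inner]
  refine Finset.sum_congr rfl fun μ hμ => ?_
  rw [inner_sum, Finset.sum_eq_single μ]
  · rw [real_inner_smul_left, real_inner_smul_right, real_inner_self_eq_norm_sq]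
    ring
  · intro ν _ hν
    rw [real_inner_smul_left, real_inner_smul_right, inner_eq_zero_of_eigen hA hν.symm
      (apply_eigenProj A μ v) (apply_eigenProj A ν v), mul_zero, mul_zero]
  · exact fun h => absurd hμ h

theorem eigenWeight_eq (A : Matrix V V ℝ) (μ : ℝ) :
    eigenWeight A μ = ‖eigenProj A μ ones‖ ^ 2 := by
  have := Submodule.starProjection_inner_eq_zero
    (K := Module.End.eigenspace (Matrix.toEuclideanLin A) μ) ones (eigenProj A μ ones)
    (Submodule.starProjection_apply_mem _ _)
  rw [inner_sub_left, sub_eq_zero] at this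
  rw [eigenWeight, this, real_inner_self_eq_norm_sq]

theorem eigenWeight_nonneg (A : Matrix V V ℝ) (μ : ℝ) : 0 ≤ eigenWeight A μ := by
  rw [eigenWeight_eq]; positivity

theorem mem_walkDomain {A : Matrix V V ℝ} {x : ℝ} :
    x ∈ walkDomain A ↔ ∀ μ ∈ spec A, 1 - μ * x = 0 → eigenWeight A μ = 0 := by
  simp [walkDomain]

/-! ### The resolvent vector -/

/-- The minimal-norm solution `w` of `(I - x A) w = 𝟏` when `x ∈ walkDomain A`: an eigenvalue with
`1 - μ x = 0` contributes nothing because `0⁻¹ = 0`. -/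
def resolventVec (A : Matrix V V ℝ) (x : ℝ) : EuclideanSpace ℝ V :=
  ∑ μ ∈ spec A, (1 - μ * x)⁻¹ • eigenProj A μ ones

theorem apply_resolventVec (A : Matrix V V ℝ) (x : ℝ) :
    Matrix.toEuclideanLin A (resolventVec A x) =
      ∑ μ ∈ spec A, ((1 - μ * x)⁻¹ * μ) • eigenProj A μ ones := by
  rw [resolventVec, map_sum]
  exact Finset.sum_congr rfl fun μ _ => by rw [map_smul, apply_eigenProj, smul_smul]

theorem resolventVec_sub {A : Matrix V V ℝ} (hA : A.IsSymm) {x : ℝ} (hx : x ∈ walkDomain A) :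
    resolventVec A x - x • Matrix.toEuclideanLin A (resolventVec A x) = ones := by
  rw [apply_resolventVec, resolventVec, Finset.smul_sum, ← Finset.sum_sub_distrib]
  conv_rhs => rw [← sum_eigenProj hA ones]
  refine Finset.sum_congr rfl fun μ hμ => ?_
  rw [smul_smul, ← sub_smul]
  by_cases h : 1 - μ * x = 0
  · have := mem_walkDomain.mp hx μ hμ h
    rw [eigenWeight_eq, sq_eq_zero_iff, norm_eq_zero] at this
    simp [this]
  · rw [show (1 - μ * x)⁻¹ - x * ((1 - μ * x)⁻¹ * μ) = (1 - μ * x)⁻¹ * (1 - μ * x) by ring,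
      inv_mul_cancel₀ h, one_smul]

theorem inner_ones_resolventVec (A : Matrix V V ℝ) (x : ℝ) :
    inner ℝ ones (resolventVec A x) = walkGen A x := by
  rw [resolventVec, inner_sum, walkGen]
  refine Finset.sum_congr rfl fun μ _ => ?_
  rw [inner_smul_right, div_eq_inv_mul]
  rfl

theorem walkGen_zero {A : Matrix V V ℝ} (hA : A.IsSymm) : walkGen A 0 = Fintype.card V := by
  have h := resolventVec_sub (x := 0) hA (by simp [mem_walkDomain])
  rw [zero_smul, sub_zero] at h
  rw [← inner_ones_resolventVec, h, real_inner_self_eq_norm_sq, norm_ones_sq]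

/-- `W_A' (x) = ⟨w, A w⟩` for the resolvent vector `w`, also at an endpoint of the interval that is
not a pole. -/
theorem hasDerivAt_walkGen {A : Matrix V V ℝ} (hA : A.IsSymm) {x : ℝ} (hx : x ∈ walkDomain A) :
    HasDerivAt (walkGen A)
      (inner ℝ (resolventVec A x) (Matrix.toEuclideanLin A (resolventVec A x))) x := by
  have h1 : inner ℝ (resolventVec A x) (Matrix.toEuclideanLin A (resolventVec A x)) =
      ∑ μ ∈ spec A, eigenWeight A μ * μ / (1 - μ * x) ^ 2 := by
    rw [apply_resolventVec, resolventVec, inner_sum_smul_eigenProj hA]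
    refine Finset.sum_congr rfl fun μ _ => ?_
    rw [eigenWeight_eq, div_eq_mul_inv, ← inv_pow]
    ring
  rw [h1]
  refine HasDerivAt.fun_sum fun μ hμ => ?_
  by_cases h : 1 - μ * x = 0
  · rw [mem_walkDomain.mp hx μ hμ h]
    simpa using hasDerivAt_const x (0 : ℝ)
  · have h2 : HasDerivAt (fun y => 1 - μ * y) (-μ) x := by
      simpa using ((hasDerivAt_id x).const_mul μ).const_sub 1
    exact ((hasDerivAt_const x (eigenWeight A μ)).fun_div h2 h).congr_deriv (by ring)

/-! ### The interval on which `I - x A` is positive semidefinite -/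

theorem inner_sub_nonneg {A : Matrix V V ℝ} (hA : A.IsSymm) {x : ℝ}
    (hx : ∀ μ ∈ spec A, 0 ≤ 1 - μ * x) (v : EuclideanSpace ℝ V) :
    0 ≤ inner ℝ v (v - x • Matrix.toEuclideanLin A v) := by
  have h1 : v - x • Matrix.toEuclideanLin A v =
      ∑ μ ∈ spec A, (1 - μ * x) • eigenProj A μ v := by
    conv_lhs => rw [← sum_eigenProj hA v]
    rw [map_sum, Finset.smul_sum, ← Finset.sum_sub_distrib]
    refine Finset.sum_congr rfl fun μ _ => ?_
    rw [apply_eigenProj, smul_smul, sub_smul, one_smul, mul_comm]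
  have h2 := inner_sum_smul_eigenProj hA (fun _ => 1) (fun μ => 1 - μ * x) v
  simp only [one_smul, one_mul, sum_eigenProj hA] at h2
  rw [h1, h2]
  exact Finset.sum_nonneg fun μ hμ => mul_nonneg (hx μ hμ) (by positivity)

/-- Cauchy-Schwarz for the form `I - x A`, applied to `v` and the resolvent vector. -/
theorem sq_inner_ones_le {A : Matrix V V ℝ} (hA : A.IsSymm) {x : ℝ}
    (hx : ∀ μ ∈ spec A, 0 ≤ 1 - μ * x) (hd : x ∈ walkDomain A) (v : EuclideanSpace ℝ V) :
    inner ℝ ones v ^ 2 ≤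
      walkGen A x * (‖v‖ ^ 2 - x * inner ℝ v (Matrix.toEuclideanLin A v)) := by
  set T := Matrix.toEuclideanLin A
  set w := resolventVec A x with hw
  have h (r : ℝ) : 0 ≤ walkGen A x * (r * r) + (-2 * inner ℝ ones v) * r +
      (‖v‖ ^ 2 - x * inner ℝ v (T v)) := by
    refine (inner_sub_nonneg hA hx (v - r • w)).trans_eq ?_
    have h1 : (v - r • w) - x • T (v - r • w) = (v - x • T v) - r • ones := by
      rw [← resolventVec_sub hA hd, map_sub, map_smul]
      module
    have h2 : inner ℝ w (T v) = inner ℝ (T w) v := (isSymmetric_of_isSymm hA w v).symm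
    have h3 : inner ℝ ones v = inner ℝ w v - x * inner ℝ (T w) v := by
      conv_lhs => rw [← resolventVec_sub hA hd]
      rw [inner_sub_left, real_inner_smul_left]
    have h4 : inner ℝ w ones = walkGen A x := by
      rw [real_inner_comm, inner_ones_resolventVec]
    rw [h1, inner_sub_left, inner_sub_right, inner_sub_right, inner_sub_right, inner_sub_right]
    simp only [real_inner_smul_left, real_inner_smul_right]
    rw [h4, h2, real_inner_self_eq_norm_sq, real_inner_comm ones v]
    linear_combination r * h3
  have := discrim_le_zero h
  rw [discrim] at this
  linarith

theorem exists_spec_pos {A : Matrix V V ℝ} (hA : A.IsSymm) (h0 : A ≠ 0) (hd : ∀ i, A i i = 0) :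
    (∃ μ ∈ spec A, 0 < μ) ∧ ∃ μ ∈ spec A, μ < 0 := by
  have hH : A.IsHermitian := by
    rw [Matrix.IsHermitian, Matrix.conjTranspose_eq_transpose_of_trivial]; exact hA
  have htr : ∑ i, hH.eigenvalues i = 0 := by
    have := hH.trace_eq_sum_eigenvalues
    simpa [Matrix.trace, hd] using this.symm
  have hmem (i : V) : hH.eigenvalues i ∈ spec A := by
    rw [Set.Finite.mem_toFinset]
    exact hH.eigenvalues_mem_spectrum_real i
  have hne : ∃ i, hH.eigenvalues i ≠ 0 := by
    by_contra! h
    exact h0 (hH.eigenvalues_eq_zero_iff.mp (funext h))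
  obtain ⟨i, -, hi⟩ := Finset.exists_pos_of_sum_zero_of_exists_nonzero _ htr
    (hne.imp fun i hi => ⟨Finset.mem_univ i, hi⟩)
  obtain ⟨j, -, hj⟩ := Finset.exists_pos_of_sum_zero_of_exists_nonzero (s := Finset.univ)
    (fun i => -hH.eigenvalues i) (by simp [htr])
    (hne.imp fun i hi => ⟨Finset.mem_univ i, neg_ne_zero.mpr hi⟩)
  exact ⟨⟨_, hmem i, hi⟩, _, hmem j, neg_pos.mp hj⟩

theorem mem_walkInterval [Nonempty V] {A : Matrix V V ℝ} (hA : A.IsSymm) (hd : ∀ i, A i i = 0)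
    {x : ℝ} : x ∈ walkInterval A ↔ ∀ μ ∈ spec A, 0 ≤ 1 - μ * x := by
  rw [walkInterval]
  split_ifs with h0
  · subst h0
    simp
  · obtain ⟨⟨p, hp, hp0⟩, q, hq, hq0⟩ := exists_spec_pos hA h0 hd
    have hfin : (spectrum ℝ A).Finite := Matrix.finite_real_spectrum
    have hne : (spectrum ℝ A).Nonempty := ⟨p, hfin.mem_toFinset.mp hp⟩
    have hmax : maxEigenvalue A ∈ spec A := hfin.mem_toFinset.mpr (hne.csSup_mem hfin)
    have hmin : minEigenvalue A ∈ spec A := hfin.mem_toFinset.mpr (hne.csInf_mem hfin)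
    have hle (μ) (hμ : μ ∈ spec A) : μ ≤ maxEigenvalue A :=
      le_csSup hfin.bddAbove (hfin.mem_toFinset.mp hμ)
    have hge (μ) (hμ : μ ∈ spec A) : minEigenvalue A ≤ μ :=
      csInf_le hfin.bddBelow (hfin.mem_toFinset.mp hμ)
    have hmaxpos : 0 < maxEigenvalue A := hp0.trans_le (hle p hp)
    have hminneg : minEigenvalue A < 0 := (hge q hq).trans_lt hq0
    rw [Set.mem_Icc, inv_eq_one_div, inv_eq_one_div, div_le_iff_of_neg' hminneg,
      le_div_iff₀' hmaxpos]
    refine ⟨fun ⟨h1, h2⟩ μ hμ => sub_nonneg.mpr ?_, fun h =>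
      ⟨sub_nonneg.mp (h _ hmin), sub_nonneg.mp (h _ hmax)⟩⟩
    rcases le_total 0 x with hx | hx
    · exact (mul_le_mul_of_nonneg_right (hle μ hμ) hx).trans h2
    · exact (mul_le_mul_of_nonpos_right (hge μ hμ) hx).trans h1

/-! ### The minimum of the walk-generating function -/

/-- The minimum of `W_A` is attained. For `A ≠ 0`, the points of the interval where
`c_μ ≤ n (1 - μ x)` for all `μ`, with `c_μ = ⟨𝟏, P_μ 𝟏⟩`, form a compact set on which `W_A` is
continuous, and outside it some single term already exceeds `n = W_A(0)`. -/
theorem exists_isMinOn_walkGen [Nonempty V] {A : Matrix V V ℝ} (hA : A.IsSymm)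
    (hd : ∀ i, A i i = 0) :
    ∃ x ∈ walkInterval A ∩ walkDomain A,
      IsMinOn (walkGen A) (walkInterval A ∩ walkDomain A) x := by
  have hzero : (0 : ℝ) ∈ walkInterval A ∩ walkDomain A :=
    ⟨(mem_walkInterval hA hd).mpr (by simp), by simp [mem_walkDomain]⟩
  by_cases h0 : A = 0
  · refine ⟨0, hzero, fun x _ => ?_⟩
    subst h0
    change walkGen 0 0 ≤ walkGen 0 x
    refine (Finset.sum_congr rfl fun μ hμ => ?_).le
    have hμ0 : μ = 0 := by simpa [spectrum.zero_eq] using hμ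
    simp [hμ0]
  set n : ℝ := ((Fintype.card V : ℕ) : ℝ) with hn
  have hnpos : 0 < n := by simp [hn, Fintype.card_pos]
  set K := walkInterval A ∩ {x | ∀ μ ∈ spec A, eigenWeight A μ ≤ n * (1 - μ * x)} with hK
  have hKdom : ∀ x ∈ K, x ∈ walkDomain A := by
    intro x hx
    refine mem_walkDomain.mpr fun μ hμ h => le_antisymm ?_ (eigenWeight_nonneg A μ)
    simpa [h] using hx.2 μ hμ
  have hcomp : IsCompact K := by
    rw [hK, walkInterval, if_neg h0]
    refine isCompact_Icc.inter_right ?_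
    have : {x | ∀ μ ∈ spec A, eigenWeight A μ ≤ n * (1 - μ * x)} =
        ⋂ μ ∈ spec A, {x | eigenWeight A μ ≤ n * (1 - μ * x)} := by
      ext; simp
    rw [this]
    exact isClosed_biInter fun μ _ => isClosed_le continuous_const (by fun_prop)
  have hzK : (0 : ℝ) ∈ K := by
    refine ⟨hzero.1, fun μ _ => ?_⟩
    rw [mul_zero, sub_zero, mul_one, hn, ← norm_ones_sq, eigenWeight_eq]
    gcongr
    exact Submodule.norm_starProjection_apply_le _ _
  obtain ⟨x, hx, hmin⟩ := hcomp.exists_isMinOn ⟨0, hzK⟩ fun x hx =>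
    (hasDerivAt_walkGen hA (hKdom x hx)).continuousAt.continuousWithinAt
  refine ⟨x, ⟨hx.1, hKdom x hx⟩, fun y hy => ?_⟩
  by_cases hyK : y ∈ K
  · exact hmin hyK
  have h1 : ∃ μ ∈ spec A, n * (1 - μ * y) < eigenWeight A μ := by
    by_contra! h
    exact hyK ⟨hy.1, h⟩
  obtain ⟨μ, hμ, hlt⟩ := h1
  have hnn := (mem_walkInterval hA hd).mp hy.1
  have hpos : 0 < 1 - μ * y := by
    refine (hnn μ hμ).lt_of_ne fun h => ?_
    rw [← h, mem_walkDomain.mp hy.2 μ hμ h.symm] at hlt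
    simp at hlt
  calc walkGen A x ≤ walkGen A 0 := hmin hzK
    _ = n := walkGen_zero hA
    _ ≤ eigenWeight A μ / (1 - μ * y) := (le_div_iff₀ hpos).mpr hlt.le
    _ ≤ walkGen A y := Finset.single_le_sum
      (f := fun μ => eigenWeight A μ / (1 - μ * y))
      (fun ν hν => div_nonneg (eigenWeight_nonneg A ν) (hnn ν hν)) hμ

theorem isLeast_walkValues [Nonempty V] {A : Matrix V V ℝ} (hA : A.IsSymm)
    (hd : ∀ i, A i i = 0) : IsLeast (walkValues A) (walkMin A) := by
  obtain ⟨x, hx, hmin⟩ := exists_isMinOn_walkGen hA hd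
  have h : IsLeast (walkValues A) (walkGen A x) :=
    ⟨⟨x, hx, rfl⟩, Set.forall_mem_image.mpr fun y hy => hmin hy⟩
  rwa [walkMin, h.csInf_eq]

/-- First-order condition at a minimum `x` with `W_A'(x) ≠ 0`: moving `x` against the derivative must
leave the interval, so some eigenvalue of sign opposite to `W_A'(x)` has `1 - μ x = 0`. -/
theorem exists_spec_mul_neg [Nonempty V] {A : Matrix V V ℝ} (hA : A.IsSymm)
    (hd : ∀ i, A i i = 0) {x D : ℝ} (hx : x ∈ walkInterval A ∩ walkDomain A)
    (hmin : IsMinOn (walkGen A) (walkInterval A ∩ walkDomain A) x)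
    (hD : HasDerivAt (walkGen A) D x) (hD0 : D ≠ 0) :
    ∃ μ ∈ spec A, 1 - μ * x = 0 ∧ μ * D < 0 := by
  by_contra! hcon
  have hev : ∀ᶠ ε in nhdsWithin (0 : ℝ) (Set.Ioi 0), ∀ μ ∈ spec A,
      0 < 1 - μ * (x - ε * D) := by
    rw [Finset.eventually_all]
    intro μ hμ
    by_cases h : 1 - μ * x = 0
    · have hμD : 0 < μ * D := (hcon μ hμ h).lt_of_ne' (mul_ne_zero (by rintro rfl; simp at h) hD0)
      filter_upwards [self_mem_nhdsWithin] with ε hε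
      have := mul_pos (Set.mem_Ioi.mp hε) hμD
      linarith
    · have hpos : 0 < 1 - μ * x := ((mem_walkInterval hA hd).mp hx.1 μ hμ).lt_of_ne' h
      have hc : Continuous fun ε : ℝ => 1 - μ * (x - ε * D) := by fun_prop
      exact nhdsWithin_le_nhds (hc.continuousAt.eventually_const_lt (by simpa using hpos))
  have hev2 : ∀ᶠ ε in nhdsWithin (0 : ℝ) (Set.Ioi 0), walkGen A (x - ε * D) < walkGen A x := by
    have hg : HasDerivAt (fun ε : ℝ => walkGen A (x - ε * D)) (-(D * D)) 0 := by
      have h1 : HasDerivAt (fun ε : ℝ => x - ε * D) (-D) 0 := by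
        simpa using ((hasDerivAt_id (0 : ℝ)).mul_const D).const_sub x
      have h2 : HasDerivAt (walkGen A) D (x - 0 * D) := by simpa using hD
      have h3 : HasDerivAt (fun ε : ℝ => walkGen A (x - ε * D)) (D * -D) 0 :=
        HasDerivAt.comp (h₂ := walkGen A) (h := fun ε : ℝ => x - ε * D) (0 : ℝ) h2 h1
      exact h3.congr_deriv (by ring)
    have hneg : -(D * D) < 0 := neg_neg_of_pos (mul_self_pos.mpr hD0)
    have hs := (hasDerivAt_iff_tendsto_slope.mp hg).eventually_lt_const hneg
    have hs' := nhdsWithin_mono (0 : ℝ) (fun y hy => ne_of_gt hy : Set.Ioi (0 : ℝ) ⊆ {0}ᶜ) hs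
    filter_upwards [hs', self_mem_nhdsWithin] with ε h1 h2
    simp only [slope_def_field, zero_mul, sub_zero] at h1
    by_contra! h
    exact h1.not_ge (div_nonneg (sub_nonneg.mpr h) (Set.mem_Ioi.mp h2).le)
  obtain ⟨ε, h1, h2⟩ := (hev.and hev2).exists
  refine h2.not_ge (hmin ⟨(mem_walkInterval hA hd).mpr fun μ hμ => (h1 μ hμ).le, ?_⟩)
  exact mem_walkDomain.mpr fun μ hμ h => absurd h (h1 μ hμ).ne'

/-- At a minimum `x` of `W_A` the supremum defining the spherical independence number reaches the value
`W_A(x)`. The vector is the resolvent vector `w`, corrected at an endpoint by an orthogonal eigenvector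
that cancels `⟨w, A w⟩`. -/
theorem exists_indepSphere_norm_sq_eq [Nonempty V] {A : Matrix V V ℝ} (hA : A.IsSymm)
    (hd : ∀ i, A i i = 0) {x : ℝ} (hx : x ∈ walkInterval A ∩ walkDomain A)
    (hmin : IsMinOn (walkGen A) (walkInterval A ∩ walkDomain A) x) :
    ∃ v ∈ indepSphere (V := V), inner ℝ v (Matrix.toEuclideanLin A v) = 0 ∧
      walkGen A x = ‖v‖ ^ 2 := by
  set T := Matrix.toEuclideanLin A
  set w := resolventVec A x with hw
  have hres : w - x • T w = ones := resolventVec_sub hA hx.2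
  have hW : inner ℝ ones w = walkGen A x := inner_ones_resolventVec A x
  have hTs : T.IsSymmetric := isSymmetric_of_isSymm hA
  set D := inner ℝ w (T w) with hDdef
  have hD : HasDerivAt (walkGen A) D x := hasDerivAt_walkGen hA hx.2
  have hnorm : ‖w‖ ^ 2 - x * D = walkGen A x := by
    rw [← hW, ← hres, inner_sub_left, real_inner_smul_left, real_inner_self_eq_norm_sq, hTs w w]
  obtain ⟨z, hzw, hze, hzz, hzT⟩ : ∃ z : EuclideanSpace ℝ V, inner ℝ w z = 0 ∧
      inner ℝ ones z = 0 ∧ ‖z‖ ^ 2 = -(x * D) ∧ (inner ℝ z (T z) = -D ∧ inner ℝ w (T z) = 0) := by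
    by_cases hD0 : D = 0
    · exact ⟨0, by simp [hD0]⟩
    obtain ⟨μ, hμ, h1, h2⟩ := exists_spec_mul_neg hA hd hx hmin hD hD0
    obtain ⟨y, hy⟩ := (mem_spec.mp hμ).exists_hasEigenvector
    have hy0 : ‖y‖ ≠ 0 := norm_ne_zero_iff.mpr hy.2
    have hyT : T y = μ • y := hy.apply_eq_smul
    have hxμ : μ * x = 1 := by linarith
    have hxD : 0 ≤ -(x * D) := by
      have : x * D = x ^ 2 * (μ * D) := by linear_combination (-(x * D)) * hxμ
      nlinarith [sq_nonneg x]
    -- the coefficient of `P_μ 𝟏` in `w` is `0⁻¹ = 0`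
    have hwy : inner ℝ w y = 0 := by
      rw [hw, resolventVec, sum_inner]
      refine Finset.sum_eq_zero fun ν _ => ?_
      rw [real_inner_smul_left]
      by_cases hν : ν = μ
      · rw [hν, h1, inv_zero, zero_mul]
      · rw [inner_eq_zero_of_eigen hA hν (apply_eigenProj A ν _) hyT, mul_zero]
    have hwTy : inner ℝ w (T y) = 0 := by rw [hyT, real_inner_smul_right, hwy, mul_zero]
    have hs : √(-(x * D)) ^ 2 = -(x * D) := Real.sq_sqrt hxD
    have hnz : ‖(√(-(x * D)) / ‖y‖) • y‖ ^ 2 = -(x * D) := by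
      rw [norm_smul, mul_pow, Real.norm_eq_abs, sq_abs, div_pow, hs]
      field_simp
    refine ⟨(√(-(x * D)) / ‖y‖) • y, ?_, ?_, hnz, ?_, ?_⟩
    · rw [real_inner_smul_right, hwy, mul_zero]
    · rw [real_inner_smul_right, ← hres, inner_sub_left, real_inner_smul_left, hTs w y, hwTy, hwy]
      simp
    · rw [map_smul, hyT, smul_comm, real_inner_smul_right, real_inner_self_eq_norm_sq, hnz]
      linear_combination (-D) * hxμ
    · rw [map_smul, real_inner_smul_right, hwTy, mul_zero]
  have hv : walkGen A x = ‖w + z‖ ^ 2 := by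
    rw [norm_add_sq_real, hzw, hzz]
    linarith
  refine ⟨w + z, mem_indepSphere_iff.mpr ?_, ?_, hv⟩
  · rw [← hv, inner_add_right, hze, hW, add_zero]
  · rw [map_add, inner_add_left, inner_add_right, inner_add_right, hzT.1, hzT.2, ← hTs z w,
      real_inner_comm w (T z), hzT.2]
    ring

/-- The inner supremum of the spherical independence number equals the minimum of `W_A`. -/
theorem isGreatest_walkMin [Nonempty V] {A : Matrix V V ℝ} (hA : A.IsSymm)
    (hd : ∀ i, A i i = 0) :
    IsGreatest {s : ℝ | ∃ v ∈ indepSphere (V := V),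
      inner ℝ v (Matrix.toEuclideanLin A v) = 0 ∧ s = ‖v‖ ^ 2} (walkMin A) := by
  obtain ⟨x, hx, hmin⟩ := exists_isMinOn_walkGen hA hd
  have h : IsLeast (walkValues A) (walkGen A x) :=
    ⟨⟨x, hx, rfl⟩, Set.forall_mem_image.mpr fun y hy => hmin hy⟩
  rw [walkMin, h.csInf_eq]
  refine ⟨exists_indepSphere_norm_sq_eq hA hd hx hmin, ?_⟩
  rintro _ ⟨v, hv, hv0, rfl⟩
  have := sq_inner_ones_le hA ((mem_walkInterval hA hd).mp hx.1) hx.2 v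
  rw [hv0, mem_indepSphere_iff.mp hv, mul_zero, sub_zero, sq] at this
  by_cases h0 : ‖v‖ ^ 2 = 0
  · rw [h0]
    exact Finset.sum_nonneg fun μ hμ =>
      div_nonneg (eigenWeight_nonneg A μ) ((mem_walkInterval hA hd).mp hx.1 μ hμ)
  · exact le_of_mul_le_mul_right this (lt_of_le_of_ne (sq_nonneg _) (Ne.symm h0))

/-! ### The semidefinite form of the Lovász number -/

/-- The real numbers `t` for which some weighted adjacency matrix `A` of `G` makes `t I + A - J`
positive semidefinite, `J` being the all-ones matrix. -/
def semidefValues (G : SimpleGraph V) : Set ℝ :=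
  {t | ∃ A ∈ weightedAdjacency G, ∀ v : EuclideanSpace ℝ V,
    inner ℝ ones v ^ 2 ≤ t * ‖v‖ ^ 2 + inner ℝ v (Matrix.toEuclideanLin A v)}

/-- The off-diagonal part of the Gram matrix of the vectors `u_i / ⟨c, u_i⟩` is the weighted adjacency
matrix, and the inequality is Cauchy-Schwarz for `c` and `∑ i, (v_i / ⟨c, u_i⟩) u_i`. -/
theorem lovaszValues_subset_semidefValues (G : SimpleGraph V) :
    lovaszValues G ⊆ semidefValues G := by
  rintro t ⟨N, u, c, ⟨hu1, hu2⟩, hc, hne, rfl⟩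
  set t := ⨆ i, 1 / (inner ℝ c (u i)) ^ 2 with ht
  have hle (i : V) : 1 / (inner ℝ c (u i)) ^ 2 ≤ t :=
    le_ciSup (f := fun i => 1 / (inner ℝ c (u i)) ^ 2) (Set.finite_range _).bddAbove i
  set B : V → V → ℝ := fun i j => inner ℝ (u i) (u j) / (inner ℝ c (u i) * inner ℝ c (u j)) with hB
  refine ⟨Matrix.of fun i j => if i = j then 0 else B i j, ⟨?_, ?_⟩, fun v => ?_⟩
  · ext i j
    simp only [Matrix.transpose_apply, Matrix.of_apply, hB, eq_comm (a := j)]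
    rw [real_inner_comm, mul_comm]
  · intro i j h
    by_cases hij : i = j
    · simp [hij]
    · simp [hij, hB, hu2 i j hij h]
  rw [inner_toEuclideanLin]
  set y := ∑ i, (v i / inner ℝ c (u i)) • u i with hy
  have hcy : inner ℝ c y = inner ℝ ones v := by
    rw [inner_ones, hy, inner_sum]
    refine Finset.sum_congr rfl fun i _ => ?_
    rw [real_inner_smul_right, div_mul_cancel₀ _ (hne i)]
  have hyy : ‖y‖ ^ 2 = ∑ i, ∑ j, B i j * v i * v j := by
    rw [← real_inner_self_eq_norm_sq, hy, sum_inner]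
    refine Finset.sum_congr rfl fun i _ => ?_
    rw [inner_sum]
    refine Finset.sum_congr rfl fun j _ => ?_
    rw [real_inner_smul_left, real_inner_smul_right, hB]
    ring
  have hcs : inner ℝ ones v ^ 2 ≤ ‖y‖ ^ 2 := by
    rw [← hcy, sq_le_sq, abs_norm]
    simpa [hc] using abs_real_inner_le_norm c y
  refine hcs.trans ?_
  rw [hyy, EuclideanSpace.real_norm_sq_eq, Finset.mul_sum, ← Finset.sum_add_distrib]
  refine Finset.sum_le_sum fun i _ => ?_
  have hsplit : ∑ j, B i j * v i * v j = B i i * v i * v i +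
      ∑ j, (if i = j then 0 else B i j) * v i * v j := by
    rw [← Finset.add_sum_erase _ _ (Finset.mem_univ i), ← Finset.add_sum_erase Finset.univ
      (fun j => (if i = j then 0 else B i j) * v i * v j) (Finset.mem_univ i)]
    simp only [if_true, zero_mul, zero_add, add_right_inj]
    refine Finset.sum_congr rfl fun j hj => ?_
    rw [if_neg (Finset.ne_of_mem_erase hj).symm]
  have hBii : B i i ≤ t := by
    refine (hle i).trans' (le_of_eq ?_)
    simp only [hB, real_inner_self_eq_norm_sq, hu1]
    ring
  have := mul_le_mul_of_nonneg_right hBii (sq_nonneg (v i))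
  simp only [Matrix.of_apply]
  rw [hsplit]
  linarith

omit [Fintype V] [DecidableEq V] in
theorem diag_eq_zero {G : SimpleGraph V} {A : Matrix V V ℝ} (hA : A ∈ weightedAdjacency G) (i : V) :
    A i i = 0 := hA.2 i i (G.irrefl)

/-- The form `t I + A - J` evaluated at `p e_i + q e_j`. -/
theorem sq_add_le_of_mem {G : SimpleGraph V} {A : Matrix V V ℝ} (hA : A ∈ weightedAdjacency G) {t : ℝ}
    (h : ∀ v : EuclideanSpace ℝ V,
      inner ℝ ones v ^ 2 ≤ t * ‖v‖ ^ 2 + inner ℝ v (Matrix.toEuclideanLin A v))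
    {i j : V} (hij : i ≠ j) (p q : ℝ) :
    (p + q) ^ 2 ≤ t * (p ^ 2 + q ^ 2) + 2 * p * q * A i j := by
  have := h (EuclideanSpace.single i p + EuclideanSpace.single j q)
  rw [norm_add_sq_real, inner_toEuclideanLin, inner_ones] at this
  simp [Finset.sum_add_distrib, mul_add, add_mul, diag_eq_zero hA, hA.1.apply i j,
    EuclideanSpace.inner_single_left, hij] at this
  linarith

theorem one_le_of_mem_semidefValues [Nonempty V] {G : SimpleGraph V} {t : ℝ}
    (ht : t ∈ semidefValues G) : 1 ≤ t := by
  obtain ⟨A, hA, h⟩ := ht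
  obtain ⟨i⟩ := ‹Nonempty V›
  have := h (EuclideanSpace.single i 1)
  rw [inner_toEuclideanLin, inner_ones] at this
  simpa [diag_eq_zero hA] using this

theorem semidefValues_subset_lovaszValues [Nonempty V] (G : SimpleGraph V) :
    semidefValues G ⊆ lovaszValues G := by
  intro t ht
  have ht1 := one_le_of_mem_semidefValues ht
  have ht0 : 0 < t := by linarith
  obtain ⟨A, hA, h⟩ := ht
  set M : Matrix V V ℝ := t • 1 + A - Matrix.of fun _ _ => 1 with hM
  have hMs : M.PosSemidef := by
    refine Matrix.PosSemidef.of_dotProduct_mulVec_nonneg ?_ fun v => ?_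
    · rw [Matrix.IsHermitian, Matrix.conjTranspose_eq_transpose_of_trivial, hM,
        Matrix.transpose_sub, Matrix.transpose_add, hA.1.eq, Matrix.transpose_smul,
        Matrix.transpose_one]
      rfl
    · have hv := h (WithLp.toLp 2 v)
      rw [inner_ones] at hv
      have hJ : (Matrix.of fun _ _ => (1 : ℝ) : Matrix V V ℝ) *ᵥ v = fun _ => ∑ i, v i := by
        ext i; simp [Matrix.mulVec, dotProduct]
      rw [hM, Matrix.sub_mulVec, Matrix.add_mulVec, Matrix.smul_mulVec, Matrix.one_mulVec, hJ,
        dotProduct_sub, dotProduct_add, dotProduct_smul]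
      have h1 : star v ⬝ᵥ (fun _ => ∑ i, v i) = (∑ i, v i) ^ 2 := by
        simp [dotProduct, ← Finset.sum_mul, sq]
      have h2 : star v ⬝ᵥ v = ‖WithLp.toLp 2 v‖ ^ 2 := by
        rw [EuclideanSpace.real_norm_sq_eq]
        simp [dotProduct, sq]
      have h3 : star v ⬝ᵥ A *ᵥ v =
          inner ℝ (WithLp.toLp 2 v) (Matrix.toEuclideanLin A (WithLp.toLp 2 v)) := by
        simp [Matrix.toEuclideanLin, Matrix.toLpLin_apply, dotProduct, PiLp.inner_apply, mul_comm]
      rw [h1, h2, h3, smul_eq_mul]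
      simp only at hv
      linarith
  open scoped MatrixOrder in
  obtain ⟨B, hB⟩ := CStarAlgebra.nonneg_iff_eq_star_mul_self.mp hMs.nonneg
  have hBM (i j : V) : ∑ k, B k i * B k j = M i j := by
    rw [hB, Matrix.mul_apply]
    simp [Matrix.star_apply]
  -- the extra coordinate `none` carries the handle `c`
  let L : EuclideanSpace ℝ (Option V) ≃ₗᵢ[ℝ] EuclideanSpace ℝ (Fin (Fintype.card (Option V))) :=
    LinearIsometryEquiv.piLpCongrLeft 2 ℝ ℝ (Fintype.equivFin (Option V))
  let u : V → EuclideanSpace ℝ (Option V) := fun i =>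
    (√t)⁻¹ • WithLp.toLp 2 fun o => o.elim 1 fun k => B k i
  let c : EuclideanSpace ℝ (Option V) := EuclideanSpace.single none 1
  have hst : (√t)⁻¹ * (√t)⁻¹ = t⁻¹ := by rw [← mul_inv, Real.mul_self_sqrt ht0.le]
  have huu (i j : V) : inner ℝ (u i) (u j) = t⁻¹ * (1 + M i j) := by
    rw [real_inner_smul_left, real_inner_smul_right, ← mul_assoc, hst, PiLp.inner_apply,
      Fintype.sum_option, ← hBM]
    simp [mul_comm]
  have hcu (i : V) : inner ℝ c (u i) = (√t)⁻¹ := by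
    simp [c, u, EuclideanSpace.inner_single_left]
  have hval (i : V) : 1 / (inner ℝ (L c) (L (u i))) ^ 2 = t := by
    rw [L.inner_map_map, hcu, inv_pow, Real.sq_sqrt ht0.le, one_div, inv_inv]
  refine ⟨_, fun i => L (u i), L c, ⟨fun i => ?_, fun i j hij hadj => ?_⟩, ?_, fun i => ?_, ?_⟩
  · have : ‖u i‖ ^ 2 = 1 := by
      rw [← real_inner_self_eq_norm_sq, huu, hM]
      simp [diag_eq_zero hA]
      field_simp
    rw [L.norm_map]
    exact (pow_eq_one_iff_of_nonneg (norm_nonneg _) two_ne_zero).mp this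
  · rw [L.inner_map_map, huu, hM]
    simp [hij, hA.2 i j hadj]
  · rw [L.norm_map]; simp [c]
  · rw [L.inner_map_map, hcu]
    exact inv_ne_zero (Real.sqrt_pos.mpr ht0).ne'
  · simp only [hval, ciSup_const]

omit [DecidableEq V] in
theorem sq_inner_ones_le_card (v : EuclideanSpace ℝ V) :
    inner ℝ ones v ^ 2 ≤ Fintype.card V * ‖v‖ ^ 2 := by
  rw [← norm_ones_sq, ← mul_pow, sq_le_sq, abs_mul, abs_norm, abs_norm]
  exact abs_real_inner_le_norm _ _

/-- The optimum of the semidefinite program is attained, since the pairs `(t, A)` with `t ≤ n` form a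
compact set. -/
theorem exists_isLeast_semidefValues [Nonempty V] (G : SimpleGraph V) :
    ∃ t, IsLeast (semidefValues G) t := by
  set n : ℝ := ((Fintype.card V : ℕ) : ℝ) with hn
  let F : Set (ℝ × (V → V → ℝ)) := {p | (∀ i j, p.2 j i = p.2 i j) ∧
    (∀ i j, ¬ G.Adj i j → p.2 i j = 0) ∧ ∀ v : EuclideanSpace ℝ V,
      inner ℝ ones v ^ 2 ≤ p.1 * ‖v‖ ^ 2 + ∑ i, ∑ j, p.2 i j * v i * v j}
  have hF {t : ℝ} {A : V → V → ℝ} : (t, A) ∈ F ↔ Matrix.of A ∈ weightedAdjacency G ∧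
      ∀ v : EuclideanSpace ℝ V, inner ℝ ones v ^ 2 ≤
        t * ‖v‖ ^ 2 + inner ℝ v (Matrix.toEuclideanLin (Matrix.of A) v) := by
    simp only [inner_toEuclideanLin, F, weightedAdjacency, Set.mem_ofPred_eq, and_assoc,
      Matrix.IsSymm.ext_iff, Matrix.of_apply]
  have hclosed : IsClosed F := by
    refine IsClosed.and ?_ (IsClosed.and ?_ ?_)
    · simp only [Set.ofPred_forall]
      exact isClosed_iInter fun i => isClosed_iInter fun j =>
        isClosed_eq (by fun_prop) (by fun_prop)
    · simp only [Set.ofPred_forall]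
      exact isClosed_iInter fun i => isClosed_iInter fun j => isClosed_iInter fun _ =>
        isClosed_eq (by fun_prop) continuous_const
    · simp only [Set.ofPred_forall]
      exact isClosed_iInter fun v => isClosed_le continuous_const (by fun_prop)
  have hcompact : IsCompact (F ∩ Set.Icc ((0 : ℝ), fun _ _ => -n) (n, fun _ _ => n)) :=
    isCompact_Icc.inter_left hclosed
  have hmem0 : ((n, fun _ _ => 0) : ℝ × (V → V → ℝ)) ∈
      F ∩ Set.Icc ((0 : ℝ), fun _ _ => -n) (n, fun _ _ => n) := by
    have hn0 : 0 ≤ n := by positivity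
    refine ⟨⟨fun _ _ => rfl, fun _ _ _ => rfl, fun v => ?_⟩, ⟨hn0, fun _ _ => ?_⟩,
      le_rfl, fun _ _ => hn0⟩
    · simpa using sq_inner_ones_le_card v
    · simpa using hn0
  obtain ⟨⟨t, A⟩, hp, hmin⟩ := hcompact.exists_isMinOn ⟨_, hmem0⟩ continuous_fst.continuousOn
  refine ⟨t, ⟨Matrix.of A, hF.mp hp.1⟩, fun s hs => ?_⟩
  rcases le_total n s with hns | hsn
  · exact (hmin hmem0).trans hns
  have hs1 := one_le_of_mem_semidefValues hs
  obtain ⟨C, hC, hCs⟩ := hs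
  have habs (i j : V) : -s ≤ C i j ∧ C i j ≤ s := by
    by_cases hij : i = j
    · rw [hij, diag_eq_zero hC]
      constructor <;> linarith
    · have h1 := sq_add_le_of_mem hC hCs hij 1 1
      have h2 := sq_add_le_of_mem hC hCs hij 1 (-1)
      constructor <;> linarith
  exact hmin (show ((s, C) : ℝ × (V → V → ℝ)) ∈ _ from ⟨hF.mpr ⟨hC, hCs⟩,
    ⟨by simp; linarith, fun i j => by simpa using (neg_le_neg hsn).trans (habs i j).1⟩, hsn,
      fun i j => (habs i j).2.trans hsn⟩)

/-- With `x` a minimum point of `W_A` and `t = W_A(x)`, the matrix `-t x A` shows that `t` is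
feasible. -/
theorem walkMin_mem_semidefValues [Nonempty V] {G : SimpleGraph V} {A : Matrix V V ℝ}
    (hA : A ∈ weightedAdjacency G) : walkMin A ∈ semidefValues G := by
  obtain ⟨x, hx, hxt⟩ := (isLeast_walkValues hA.1 (diag_eq_zero hA)).1
  refine ⟨(-(walkMin A * x)) • A, ⟨hA.1.smul _, fun i j h => by simp [hA.2 i j h]⟩, fun v => ?_⟩
  have := sq_inner_ones_le hA.1 ((mem_walkInterval hA.1 (diag_eq_zero hA)).mp hx.1) hx.2 v
  rw [hxt] at this
  rw [map_smul, LinearMap.smul_apply, real_inner_smul_right]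
  linarith

/-- On the sphere with `⟨v, A v⟩ = 0`, feasibility of `(t, A)` reads `|v|⁴ ≤ t |v|²`. -/
theorem exists_walkMin_le [Nonempty V] {G : SimpleGraph V} {t : ℝ} (ht : t ∈ semidefValues G) :
    ∃ A ∈ weightedAdjacency G, walkMin A ≤ t := by
  have ht1 := one_le_of_mem_semidefValues ht
  obtain ⟨A, hA, h⟩ := ht
  refine ⟨A, hA, ?_⟩
  obtain ⟨v, hv, hv0, hvs⟩ := (isGreatest_walkMin hA.1 (diag_eq_zero hA)).1
  have := h v
  rw [hv0, add_zero, mem_indepSphere_iff.mp hv, ← hvs, sq] at this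
  by_contra! hlt
  exact hlt.not_ge (le_of_mul_le_mul_right this (by linarith))

end SphericalTheta

end

theorem theorem1 {V : Type*} [Fintype V] [DecidableEq V] [Nonempty V] (G : SimpleGraph V) :
    -- the minimum that defines the Lovász number is attained
    IsLeast (SphericalTheta.lovaszValues G) (SphericalTheta.lovaszNumber G) ∧
    SphericalTheta.lovaszNumber G = SphericalTheta.sphericalIndepNumber G ∧
    -- for each `A`, `W_A` attains its minimum on the interval
    (∀ A ∈ SphericalTheta.weightedAdjacency G,
      IsLeast (SphericalTheta.walkValues A) (SphericalTheta.walkMin A)) ∧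
    SphericalTheta.sphericalIndepNumber G =
      ⨅ A : SphericalTheta.weightedAdjacency G, SphericalTheta.walkMin (A : Matrix V V ℝ) := by
  open SphericalTheta in
  have hsets : lovaszValues G = semidefValues G :=
    (lovaszValues_subset_semidefValues G).antisymm (semidefValues_subset_lovaszValues G)
  obtain ⟨t, ht⟩ := exists_isLeast_semidefValues G
  have hlov : lovaszNumber G = t := by rw [lovaszNumber, hsets, ht.csInf_eq]
  have hsph : sphericalIndepNumber G = ⨅ A : weightedAdjacency G, walkMin (A : Matrix V V ℝ) :=
    iInf_congr fun A => (isGreatest_walkMin A.2.1 (diag_eq_zero A.2)).csSup_eq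
  refine ⟨by rwa [hlov, hsets], ?_, fun A hA => isLeast_walkValues hA.1 (diag_eq_zero hA), hsph⟩
  rw [hlov, hsph]
  have hle (A : weightedAdjacency G) : t ≤ walkMin (A : Matrix V V ℝ) :=
    ht.2 (walkMin_mem_semidefValues A.2)
  obtain ⟨A, hA, hAt⟩ := exists_walkMin_le ht.1
  have : Nonempty (weightedAdjacency G) := ⟨⟨A, hA⟩⟩
  exact le_antisymm (le_ciInf hle) ((ciInf_le ⟨t, Set.forall_mem_range.mpr hle⟩ ⟨A, hA⟩).trans hAt)
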